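/- Let $\mathcal{G}$ be a nonempty Hausdorff étale groupoid (a topological groupoid, Hausdorff as a space, whose domain and range maps $\gamma\mapsto\gamma^{-1}\gamma$ and $\gamma\mapsto\gamma\gamma^{-1}$ onto the unit space $\mathcal{G}^{(0)}$ are local homeomorphisms) with compact unit space, and let $p\in[1,\infty)\setminus\{2\}$. Let $C_c(\mathcal{G})$ be the algebra of compactly supported continuous functions $\mathcal{G}\to\mathbb{C}$ with the convolution $(f*g)(\gamma)=\sum_{\sigma\in\mathcal{G},\ \mathrm{dom}(\sigma)=\mathrm{dom}(\gamma)} f(\gamma\sigma^{-1})g(\sigma)$. For $x\in\mathcal{G}^{(0)}$ put $\mathcal{G}x=\{\gamma\in\mathcal{G}:\mathrm{dom}(\gamma)=x\}$ and let $\pi_x$ be the representation of $C_c(\mathcal{G})$ on $\ell^p(\mathcal{G}x)$ by left convolution, $\pi_x(f)\xi=f*\xi$. The reduced groupoid $L^p$-operator algebra $F^p_\lambda(\mathcal{G})$ is the completion of $C_c(\mathcal{G})$ in the norm $\|f\|_\lambda=\sup_{x\in\mathcal{G}^{(0)}}\|\pi_x(f)\|$; it is a unital Banach algebra. For a unital complex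 Banach algebra $A$, let $A_{\mathrm{h}}$ be the set of hermitian elements, that is, of those $a\in A$ with $\|\exp(ita)\|=1$ for all $t\in\mathbb{R}$. The $C^*$-core of a unital $L^p$-operator algebra $A$ is $\mathrm{core}(A)=A_{\mathrm{h}}+iA_{\mathrm{h}}$. Then the homomorphism $C(\mathcal{G}^{(0)})\to F^p_\lambda(\mathcal{G})$ that extends a function on $\mathcal{G}^{(0)}$ by zero to $\mathcal{G}$ is isometric, and its image is the $C^*$-core of $F^p_\lambda(\mathcal{G})$. In short, with $C(\mathcal{G}^{(0)})$ identified with its image, \[ \mathrm{core}\big(F^p_\lambda(\mathcal{G})\big)=C(\mathcal{G}^{(0)}). \] -/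

import Mathlib

open Topology
open scoped ENNReal CompactlySupported

set_option linter.unusedSectionVars false

noncomputable section

namespace LpGroupoid

/-! ### Topological groupoids -/

/-- A topological groupoid: a topological space with a set of composable pairs of arrows, a
continuous composition of composable pairs and a continuous inversion. The composition is
recorded as a total function, about whose values outside the composable pairs nothing is
assumed. -/
class TopologicalGroupoid (G : Type*) [TopologicalSpace G] where
  /-- The set of composable pairs of arrows. -/
  composable : Set (G × G)
  /-- The composition (only meaningful on composable pairs). -/
  mul : G → G → G
  /-- The inversion. -/
  inv : G → G
  continuousOn_mul : ContinuousOn (fun q : G × G => mul q.1 q.2) composable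
  continuous_inverse : Continuous inv
  mul_mem_left : ∀ {a b c : G}, (a, b) ∈ composable → (b, c) ∈ composable →
    (mul a b, c) ∈ composable
  mul_mem_right : ∀ {a b c : G}, (a, b) ∈ composable → (b, c) ∈ composable →
    (a, mul b c) ∈ composable
  assoc : ∀ {a b c : G}, (a, b) ∈ composable → (b, c) ∈ composable →
    mul (mul a b) c = mul a (mul b c)
  inverse_inverse : ∀ a : G, inv (inv a) = a
  mem_inv : ∀ a : G, (a, inv a) ∈ composable
  inv_mul_mul : ∀ {a b : G}, (a, b) ∈ composable → mul (inv a) (mul a b) = b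
  mul_mul_inv : ∀ {a b : G}, (a, b) ∈ composable → mul (mul a b) (inv b) = a

section Groupoid

open TopologicalGroupoid

variable {G : Type*} [TopologicalSpace G] [TopologicalGroupoid G]

/-- The domain (source) `a⁻¹ a` of an arrow `a`. -/
def dom (a : G) : G := mul (inv a) a

/-- The range (target) `a a⁻¹` of an arrow `a`. -/
def ran (a : G) : G := mul a (inv a)

variable (G) in
/-- The unit space: the set of all `a` with `a = a⁻¹ = a a`
(the pair `(a, a)` is composable as soon as `a = a⁻¹`). -/
def units : Set G := {a | a = inv a ∧ a = mul a a}

theorem inv_mem (a : G) : (inv a, a) ∈ composable := by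
  have := mem_inv (inv a)
  rwa [inverse_inverse] at this

theorem ran_inv (a : G) : ran (inv a) = dom a := by
  rw [ran, dom, inverse_inverse]

theorem dom_inv (a : G) : dom (inv a) = ran a := by
  rw [ran, dom, inverse_inverse]

theorem ran_mul_self (a : G) : mul (ran a) a = a := by
  have := mul_mul_inv (mem_inv a)
  rwa [inverse_inverse] at this

theorem mul_dom_self (a : G) : mul a (dom a) = a := by
  have := inv_mul_mul (inv_mem a)
  rwa [inverse_inverse] at this

theorem composable_iff {a b : G} : (a, b) ∈ composable ↔ dom a = ran b := by
  constructor
  · intro h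
    have h1 := mul_mul_inv (mul_mem_left (inv_mem a) h)
    rw [assoc (inv_mem a) h, inv_mul_mul h] at h1
    exact h1.symm
  · intro h
    have h1 : (dom a, b) ∈ composable := by
      rw [h]; exact mul_mem_left (mem_inv b) (inv_mem b)
    have h2 : (a, dom a) ∈ composable := mul_mem_right (mem_inv a) (inv_mem a)
    have h3 := mul_mem_left h2 h1
    rwa [mul_dom_self] at h3

theorem dom_mul {a b : G} (h : dom a = ran b) : dom (mul a b) = dom b := by
  have := composable_iff.1 (mul_mem_left (composable_iff.2 h) (mem_inv b))
  rwa [ran_inv] at this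

theorem ran_mul {a b : G} (h : dom a = ran b) : ran (mul a b) = ran a := by
  have := composable_iff.1 (mul_mem_right (inv_mem a) (composable_iff.2 h))
  rw [dom_inv] at this
  exact this.symm

theorem inv_mul {a b : G} (h : dom a = ran b) : inv (mul a b) = mul (inv b) (inv a) := by
  have hab : (a, b) ∈ composable := composable_iff.2 h
  have hba : (inv b, inv a) ∈ composable := by
    rw [composable_iff, dom_inv, ran_inv, h]
  have h1 : (mul a b, inv b) ∈ composable := mul_mem_left hab (mem_inv b)
  have h2 : mul (mul a b) (mul (inv b) (inv a)) = ran (mul a b) := by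
    rw [← assoc h1 hba, mul_mul_inv hab, ran_mul h, ran]
  have h3 := inv_mul_mul (mul_mem_right h1 hba)
  rw [h2, ran, inv_mul_mul (mem_inv (mul a b))] at h3
  exact h3

theorem dom_mem_units (a : G) : dom a ∈ units G := by
  constructor
  · rw [dom, inv_mul (dom_inv a), inverse_inverse]
  · have := ran_mul_self (dom a)
    rw [show ran (dom a) = dom a by rw [dom, ran_mul (dom_inv a), ran_inv, dom]] at this
    exact this.symm

theorem ran_mem_units (a : G) : ran a ∈ units G := by
  rw [← dom_inv]
  exact dom_mem_units _

theorem dom_of_mem_units {a : G} (h : a ∈ units G) : dom a = a := by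
  rw [dom, ← h.1, ← h.2]

theorem ran_of_mem_units {a : G} (h : a ∈ units G) : ran a = a := by
  rw [ran, ← h.1, ← h.2]

/-- The domain map as a map to the unit space. -/
def domMap (a : G) : units G := ⟨dom a, dom_mem_units a⟩

/-- The range map as a map to the unit space. -/
def ranMap (a : G) : units G := ⟨ran a, ran_mem_units a⟩

variable (G) in
/-- A topological groupoid is étale if its domain and range maps (as maps to the unit space)
are local homeomorphisms. -/
class IsEtale : Prop where
  isLocalHomeomorph_dom : IsLocalHomeomorph (domMap : G → units G)
  isLocalHomeomorph_ran : IsLocalHomeomorph (ranMap : G → units G)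

theorem dom_mul_inv {a b : G} (h : dom b = dom a) : dom (mul a (inv b)) = ran b := by
  rw [dom_mul (by rw [ran_inv, h]), dom_inv]

theorem ran_mul_inv {a b : G} (h : dom b = dom a) : ran (mul a (inv b)) = ran a :=
  ran_mul (by rw [ran_inv, h])

theorem mul_inv_mul {a b : G} (h : dom b = dom a) : mul (mul a (inv b)) b = a := by
  have := mul_mul_inv (composable_iff.2 (show dom a = ran (inv b) by rw [ran_inv, h]))
  rwa [inverse_inverse] at this

theorem mul_inv_eq_right {a b c : G} (hb : dom b = dom a) (hc : dom c = dom a)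
    (h : mul a (inv b) = mul a (inv c)) : b = c := by
  have h1 := inv_mul_mul
    (composable_iff.2 (show dom a = ran (inv b) by rw [ran_inv, hb]))
  have h2 := inv_mul_mul
    (composable_iff.2 (show dom a = ran (inv c) by rw [ran_inv, hc]))
  rw [h, h2] at h1
  rw [← inverse_inverse b, ← h1, inverse_inverse]

theorem mul_inv_eq_left {a b c : G} (ha : dom c = dom a) (hb : dom c = dom b)
    (h : mul a (inv c) = mul b (inv c)) : a = b := by
  rw [← mul_inv_mul ha, h, mul_inv_mul hb]

/-- `(a c⁻¹) (b c⁻¹)⁻¹ = a b⁻¹`. -/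
theorem mul_inv_mul_inv {a b c : G} (ha : dom c = dom a) (hb : dom c = dom b) :
    mul (mul a (inv c)) (inv (mul b (inv c))) = mul a (inv b) := by
  have hbc : dom b = ran (inv c) := by rw [ran_inv, hb]
  rw [inv_mul hbc, inverse_inverse]
  have h1 : (mul a (inv c), c) ∈ composable := by
    rw [composable_iff, dom_mul_inv ha]
  have h2 : (c, inv b) ∈ composable := by
    rw [composable_iff, ran_inv, hb]
  rw [← assoc h1 h2, mul_inv_mul ha]

theorem continuous_dom : Continuous (dom : G → G) :=
  continuousOn_mul.comp_continuous (continuous_inverse.prodMk continuous_id) inv_mem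

theorem continuous_ran : Continuous (ran : G → G) :=
  continuousOn_mul.comp_continuous (continuous_id.prodMk continuous_inverse) mem_inv

theorem isClosed_composable [T2Space G] :
    IsClosed (composable : Set (G × G)) := by
  have : (composable : Set (G × G)) = {q | dom q.1 = ran q.2} := by
    ext ⟨a, b⟩; exact composable_iff
  rw [this]
  exact isClosed_eq (continuous_dom.comp continuous_fst) (continuous_ran.comp continuous_snd)

theorem isClosed_units [T2Space G] : IsClosed (units G) := by
  have : units G = {a | dom a = a} := by
    ext a
    exact ⟨dom_of_mem_units, fun h => h ▸ dom_mem_units a⟩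
  rw [this]
  exact isClosed_eq continuous_dom continuous_id

theorem isOpen_units [IsEtale G] : IsOpen (units G) := by
  rw [isOpen_iff_mem_nhds]
  intro x hx
  set e := (IsEtale.isLocalHomeomorph_dom (G := G)).localInverseAt x
  have hinj := (IsEtale.isLocalHomeomorph_dom (G := G)).injOn_localInverseAt_target (x := x)
  have hU : e.target ∈ 𝓝 x := e.open_target.mem_nhds
    (IsEtale.isLocalHomeomorph_dom (G := G)).self_mem_localInverseAt_target
  have hU' : dom ⁻¹' e.target ∈ 𝓝 x := by
    apply continuous_dom.continuousAt.preimage_mem_nhds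
    rwa [dom_of_mem_units hx]
  filter_upwards [hU, hU'] with a ha ha'
  have : a = dom a := hinj ha ha' (Subtype.ext (dom_of_mem_units (dom_mem_units a)).symm)
  rw [this]
  exact dom_mem_units a

/-- Points of a compact set in the fibres of a locally injective map are uniformly bounded in
number. -/
theorem exists_encard_fiber_le {X Y : Type*} [TopologicalSpace X] [TopologicalSpace Y]
    {h : X → Y} (hh : IsLocalHomeomorph h) {K : Set X} (hK : IsCompact K) :
    ∃ N : ℕ, ∀ y, (K ∩ h ⁻¹' {y}).encard ≤ N := by
  refine hK.induction_on (p := fun s => ∃ N : ℕ, ∀ y, (s ∩ h ⁻¹' {y}).encard ≤ N) ?_ ?_ ?_ ?_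
  · exact ⟨0, fun y => by simp⟩
  · rintro s t hst ⟨N, hN⟩
    exact ⟨N, fun y => (Set.encard_le_encard (Set.inter_subset_inter_left _ hst)).trans (hN y)⟩
  · rintro s t ⟨N, hN⟩ ⟨M, hM⟩
    refine ⟨N + M, fun y => ?_⟩
    rw [Set.union_inter_distrib_right]
    push_cast
    exact (Set.encard_union_le _ _).trans (add_le_add (hN y) (hM y))
  · intro x _
    refine ⟨(hh.localInverseAt x).target, mem_nhdsWithin_of_mem_nhds
      ((hh.localInverseAt x).open_target.mem_nhds hh.self_mem_localInverseAt_target), 1, ?_⟩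
    intro y
    rw [Nat.cast_one, Set.encard_le_one_iff]
    rintro a b ⟨ha, ha'⟩ ⟨hb, hb'⟩
    exact hh.injOn_localInverseAt_target ha hb (ha'.trans hb'.symm)

end Groupoid

/-! ### Convolution -/

section Convolution

open TopologicalGroupoid

variable {G : Type*} [TopologicalSpace G] [TopologicalGroupoid G]

/-- The set of arrows with domain `x`. -/
abbrev Fiber (x : G) : Type _ := {a : G // dom a = x}

/-- Left convolution by `f` of functions on the arrows with domain `x`:
`(f * ξ)(a) = ∑ f(a b⁻¹) ξ(b)`, where `b` runs through the arrows with domain `x`.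
(For `f` continuous of compact support on an étale groupoid, only finitely many summands are
nonzero.) -/
def fiberConv (x : G) (f : G → ℂ) (ξ : Fiber x → ℂ) (a : Fiber x) : ℂ :=
  ∑ᶠ b : Fiber x, f (mul a.1 (inv b.1)) * ξ b

/-- The convolution `(f * g)(a) = ∑ f(a b⁻¹) g(b)`, where `b` runs through the arrows with
`dom b = dom a`. -/
def conv (f g : G → ℂ) (a : G) : ℂ :=
  ∑ᶠ b : Fiber (dom a), f (mul a (inv b.1)) * g b.1

theorem conv_eq_fiberConv (f g : G → ℂ) (x : G) (a : Fiber x) :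
    conv f g a.1 = fiberConv x f (fun b => g b.1) a := by
  obtain ⟨a, rfl⟩ := a
  rfl

/-- A function whose support meets all fibres of the domain and range maps in at most `N` points. -/
def FiberBound (f : G → ℂ) (N : ℕ) : Prop :=
  (∀ y, {a | ran a = y ∧ f a ≠ 0}.encard ≤ N) ∧ (∀ y, {a | dom a = y ∧ f a ≠ 0}.encard ≤ N)

theorem exists_fiberBound [IsEtale G] (f : C_c(G, ℂ)) : ∃ N, FiberBound f N := by
  obtain ⟨N, hN⟩ := exists_encard_fiber_le (IsEtale.isLocalHomeomorph_ran (G := G))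
    f.hasCompactSupport.isCompact
  obtain ⟨M, hM⟩ := exists_encard_fiber_le (IsEtale.isLocalHomeomorph_dom (G := G))
    f.hasCompactSupport.isCompact
  refine ⟨max N M, fun y => ?_, fun y => ?_⟩
  · by_cases hy : y ∈ units G
    · refine le_trans (Set.encard_le_encard ?_)
        ((hN ⟨y, hy⟩).trans (by exact_mod_cast le_max_left N M))
      rintro a ⟨h1, h2⟩
      exact ⟨subset_tsupport _ h2, Subtype.ext h1⟩
    · rw [show {a | ran a = y ∧ f a ≠ 0} = ∅ from ?_]
      · simp
      · ext a
        simp only [Set.mem_ofPred_eq, Set.mem_empty_iff_false, iff_false, not_and]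
        exact fun h => absurd (h ▸ ran_mem_units a) hy
  · by_cases hy : y ∈ units G
    · refine le_trans (Set.encard_le_encard ?_)
        ((hM ⟨y, hy⟩).trans (by exact_mod_cast le_max_right N M))
      rintro a ⟨h1, h2⟩
      exact ⟨subset_tsupport _ h2, Subtype.ext h1⟩
    · rw [show {a | dom a = y ∧ f a ≠ 0} = ∅ from ?_]
      · simp
      · ext a
        simp only [Set.mem_ofPred_eq, Set.mem_empty_iff_false, iff_false, not_and]
        exact fun h => absurd (h ▸ dom_mem_units a) hy

theorem FiberBound.row {f : G → ℂ} {N : ℕ} (h : FiberBound f N) {x : G} (a : Fiber x) :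
    {b : Fiber x | f (mul a.1 (inv b.1)) ≠ 0}.encard ≤ N := by
  have hinj : Set.InjOn (fun b : Fiber x => mul a.1 (inv b.1))
      {b : Fiber x | f (mul a.1 (inv b.1)) ≠ 0} := fun b _ c _ hbc =>
    Subtype.ext (mul_inv_eq_right (b.2.trans a.2.symm) (c.2.trans a.2.symm) hbc)
  rw [← hinj.encard_image]
  refine le_trans (Set.encard_le_encard ?_) (h.1 (ran a.1))
  rintro _ ⟨b, hb, rfl⟩
  exact ⟨ran_mul_inv (b.2.trans a.2.symm), hb⟩

theorem FiberBound.col {f : G → ℂ} {N : ℕ} (h : FiberBound f N) {x : G} (b : Fiber x) :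
    {a : Fiber x | f (mul a.1 (inv b.1)) ≠ 0}.encard ≤ N := by
  have hinj : Set.InjOn (fun a : Fiber x => mul a.1 (inv b.1))
      {a : Fiber x | f (mul a.1 (inv b.1)) ≠ 0} := fun a _ c _ hac =>
    Subtype.ext (mul_inv_eq_left (b.2.trans a.2.symm) (b.2.trans c.2.symm) hac)
  rw [← hinj.encard_image]
  refine le_trans (Set.encard_le_encard ?_) (h.2 (ran b.1))
  rintro _ ⟨a, ha, rfl⟩
  exact ⟨dom_mul_inv (b.2.trans a.2.symm), ha⟩

theorem FiberBound.finite_row {f : G → ℂ} {N : ℕ} (h : FiberBound f N) {x : G} (a : Fiber x) :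
    {b : Fiber x | f (mul a.1 (inv b.1)) ≠ 0}.Finite :=
  Set.finite_of_encard_le_coe (h.row a)

theorem fiberConv_eq_sum {x : G} {f : G → ℂ} {ξ : Fiber x → ℂ} {a : Fiber x}
    {R : Finset (Fiber x)} (hR : ∀ b : Fiber x, f (mul a.1 (inv b.1)) ≠ 0 → b ∈ R) :
    fiberConv x f ξ a = ∑ b ∈ R, f (mul a.1 (inv b.1)) * ξ b := by
  refine finsum_eq_sum_of_support_subset _ fun b hb => hR b ?_
  exact left_ne_zero_of_mul hb

/-- Right translation by the inverse of an arrow, as a bijection of fibres. -/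
def fiberShift {x : G} (c : Fiber x) : Fiber x ≃ Fiber (ran c.1) where
  toFun b := ⟨mul b.1 (inv c.1), dom_mul_inv (c.2.trans b.2.symm)⟩
  invFun b := ⟨mul b.1 c.1, by rw [dom_mul b.2, c.2]⟩
  left_inv b := Subtype.ext (mul_inv_mul (c.2.trans b.2.symm))
  right_inv b := Subtype.ext (mul_mul_inv (composable_iff.2 b.2))

theorem conv_mul_inv (f g : G → ℂ) {x : G} (a c : Fiber x) :
    conv f g (mul a.1 (inv c.1)) =
      ∑ᶠ b : Fiber x, f (mul a.1 (inv b.1)) * g (mul b.1 (inv c.1)) := by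
  have h1 := conv_eq_fiberConv f g (ran c.1) (fiberShift c a)
  change conv f g (mul a.1 (inv c.1)) = _ at h1
  rw [h1, fiberConv, ← finsum_comp_equiv (fiberShift c)]
  refine finsum_congr fun b => ?_
  simp only [fiberShift, Equiv.coe_fn_mk]
  rw [mul_inv_mul_inv (c.2.trans a.2.symm) (c.2.trans b.2.symm)]

theorem fiberConv_fiberConv {f g : G → ℂ} {N M : ℕ} (hf : FiberBound f N) (hg : FiberBound g M)
    {x : G} (ξ : Fiber x → ℂ) :
    fiberConv x f (fiberConv x g ξ) = fiberConv x (conv f g) ξ := by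
  classical
  ext a
  set R := (hf.finite_row a).toFinset with hRdef
  have hR : ∀ b : Fiber x, f (mul a.1 (inv b.1)) ≠ 0 → b ∈ R := fun b hb => by simpa [hRdef] using hb
  set T := R.biUnion fun b => (hg.finite_row b).toFinset with hTdef
  have hT : ∀ b ∈ R, ∀ c : Fiber x, g (mul b.1 (inv c.1)) ≠ 0 → c ∈ T := fun b hb c hc => by
    rw [hTdef, Finset.mem_biUnion]
    exact ⟨b, hb, by simpa using hc⟩
  have hconv : ∀ c : Fiber x, conv f g (mul a.1 (inv c.1)) =
      ∑ b ∈ R, f (mul a.1 (inv b.1)) * g (mul b.1 (inv c.1)) := fun c => by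
    rw [conv_mul_inv]
    exact finsum_eq_sum_of_support_subset _ fun b hb => hR b (left_ne_zero_of_mul hb)
  rw [fiberConv_eq_sum hR, fiberConv_eq_sum (R := T)]
  · simp_rw [hconv, Finset.sum_mul]
    rw [Finset.sum_comm]
    refine Finset.sum_congr rfl fun b hb => ?_
    rw [fiberConv_eq_sum (hT b hb), Finset.mul_sum]
    exact Finset.sum_congr rfl fun c _ => by ring
  · intro c hc
    rw [hconv] at hc
    obtain ⟨b, hb, hbc⟩ := Finset.exists_ne_zero_of_sum_ne_zero hc
    exact hT b hb c (right_ne_zero_of_mul hbc)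

theorem conv_assoc {f g : G → ℂ} {N M : ℕ} (hf : FiberBound f N) (hg : FiberBound g M)
    (h : G → ℂ) : conv (conv f g) h = conv f (conv g h) := by
  ext a
  have h1 := conv_eq_fiberConv (conv f g) h (dom a) ⟨a, rfl⟩
  have h2 := conv_eq_fiberConv f (conv g h) (dom a) ⟨a, rfl⟩
  simp only at h1 h2
  rw [h1, h2, ← fiberConv_fiberConv hf hg]
  congr 1
  ext b
  exact (conv_eq_fiberConv g h (dom a) b).symm

theorem continuous_conv [T2Space G] [IsEtale G] (f g : C_c(G, ℂ)) : Continuous (conv f g) := by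
  classical
  rw [continuous_iff_continuousAt]
  intro a₀
  have hd := IsEtale.isLocalHomeomorph_dom (G := G)
  set K := tsupport g with hKdef
  have hK : IsCompact K := g.hasCompactSupport.isCompact
  set x₀ : units G := domMap a₀
  obtain ⟨N, hN⟩ := exists_encard_fiber_le hd hK
  have hfin : (K ∩ domMap ⁻¹' {x₀}).Finite := Set.finite_of_encard_le_coe (hN x₀)
  set S : Finset G := hfin.toFinset with hSdef
  have hS : ∀ s ∈ S, domMap s = x₀ := fun s hs => ((hfin.mem_toFinset).1 hs).2
  let e : G → OpenPartialHomeomorph (units G) G := fun s => hd.localInverseAt s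
  have hex : ∀ s ∈ S, e s x₀ = s := fun s hs => by
    rw [← hS s hs]; exact hd.localInverseAt_apply_self
  have hsrc : ∀ s ∈ S, x₀ ∈ (e s).source := fun s hs => by
    rw [← hS s hs]; exact hd.apply_self_mem_localInverseAt_source
  have hec : ∀ s ∈ S, ContinuousAt (e s) x₀ := fun s hs => (e s).continuousAt (hsrc s hs)
  have ev1 : ∀ᶠ y in 𝓝 x₀, ∀ s ∈ S, y ∈ (e s).source := by
    rw [Filter.eventually_all_finset]
    exact fun s hs => (e s).open_source.mem_nhds (hsrc s hs)
  have ev2 : ∀ᶠ y in 𝓝 x₀, ∀ s ∈ S, ∀ t ∈ S, s ≠ t → e s y ≠ e t y := by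
    rw [Filter.eventually_all_finset]
    intro s hs
    rw [Filter.eventually_all_finset]
    intro t ht
    by_cases hst : s = t
    · simp [hst]
    · have hne : e s x₀ ≠ e t x₀ := by rwa [hex s hs, hex t ht]
      filter_upwards [((hec s hs).ne_iff_eventually_ne (hec t ht)).1 hne] with y hy _ using hy
  have ev3 : ∀ᶠ y in 𝓝 x₀, ∀ a ∈ K, domMap a = y → ∃ s ∈ S, a = e s y := by
    set W : Set G := ⋃ s ∈ S, (e s).target
    have hW : IsOpen W := isOpen_biUnion fun s _ => (e s).open_target
    have hC : IsClosed (domMap '' (K \ W)) := ((hK.diff hW).image hd.continuous).isClosed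
    have hx : x₀ ∉ domMap '' (K \ W) := by
      rintro ⟨a, ⟨haK, haW⟩, ha⟩
      refine haW (Set.mem_biUnion (x := a) ?_ hd.self_mem_localInverseAt_target)
      exact hfin.mem_toFinset.2 ⟨haK, ha⟩
    filter_upwards [hC.isOpen_compl.mem_nhds hx] with y hy a haK hay
    have haW : a ∈ W := by
      by_contra hcon
      exact hy ⟨a, ⟨haK, hcon⟩, hay⟩
    obtain ⟨s, hs, has⟩ := Set.mem_iUnion₂.1 haW
    refine ⟨s, hs, ?_⟩
    have := (e s).right_inv has
    rw [← hay]
    conv_lhs => rw [← this]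
    congr 1
    exact congrFun (hd.localInverseAt_symm s) a
  have hdc : ContinuousAt (domMap : G → units G) a₀ := hd.continuous.continuousAt
  have key : ∀ᶠ a in 𝓝 a₀, conv f g a =
      ∑ s ∈ S, f (mul a (inv (e s (domMap a)))) * g (e s (domMap a)) := by
    filter_upwards [hdc.eventually ev1, hdc.eventually ev2, hdc.eventually ev3] with a h1 h2 h3
    have hinj : Set.InjOn (fun s => e s (domMap a)) S := fun s hs t ht hst => by
      by_contra hne
      exact h2 s hs t ht hne hst
    rw [← Finset.sum_image (f := fun b => f (mul a (inv b)) * g b) hinj, conv]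
    refine (finsum_set_coe_eq_finsum_mem (f := fun b => f (mul a (inv b)) * g b)
      {b | dom b = dom a}).trans ?_
    refine finsum_mem_eq_sum_of_inter_support_eq (s := {b | dom b = dom a}) _ ?_
    ext b
    simp only [Set.mem_inter_iff, Set.mem_ofPred_eq, Function.mem_support, Finset.coe_image,
      Set.mem_image, Finset.mem_coe]
    refine and_congr_left fun hb => ⟨fun hba => ?_, ?_⟩
    · obtain ⟨s, hs, hbs⟩ := h3 b (subset_tsupport _ (right_ne_zero_of_mul hb)) (Subtype.ext hba)
      exact ⟨s, hs, hbs.symm⟩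
    · rintro ⟨s, hs, rfl⟩
      exact congrArg Subtype.val (hd.apply_localInverseAt_of_mem (h1 s hs))
  refine ContinuousAt.congr ?_ (key.mono fun _ h => h.symm)
  refine tendsto_finsetSum _ fun s hs => ?_
  have c1 : ContinuousAt (fun a => e s (domMap a)) a₀ := (hec s hs).comp hdc
  have c2 : ContinuousAt (fun a => mul a (inv (e s (domMap a)))) a₀ := by
    have hmem : (a₀, inv (e s (domMap a₀))) ∈ (composable : Set (G × G)) := by
      rw [composable_iff, ran_inv]
      exact (congrArg Subtype.val (hd.apply_localInverseAt_of_mem (hsrc s hs))).symm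
    have := (continuousOn_mul (G := G)) _ hmem
    refine Filter.Tendsto.comp (f := fun a => (a, inv (e s (domMap a)))) this ?_
    rw [tendsto_nhdsWithin_iff]
    refine ⟨(continuousAt_id.prodMk (continuous_inverse.continuousAt.comp c1)), ?_⟩
    filter_upwards [hdc.eventually ev1] with a h1
    rw [composable_iff, ran_inv]
    exact (congrArg Subtype.val (hd.apply_localInverseAt_of_mem (h1 s hs))).symm
  exact ((map_continuous f).continuousAt.comp c2).mul ((map_continuous g).continuousAt.comp c1)

theorem hasCompactSupport_conv [T2Space G] (f g : C_c(G, ℂ)) : HasCompactSupport (conv f g) := by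
  have hcomp : IsCompact ((fun q : G × G => mul q.1 q.2) ''
      ((tsupport f ×ˢ tsupport g) ∩ composable)) :=
    ((f.hasCompactSupport.isCompact.prod g.hasCompactSupport.isCompact).inter_right
      isClosed_composable).image_of_continuousOn
      (continuousOn_mul.mono Set.inter_subset_right)
  refine HasCompactSupport.intro hcomp fun a ha => ?_
  rw [conv, ← finsum_zero (α := Fiber (dom a))]
  refine finsum_congr fun b => ?_
  by_contra hne
  refine ha ⟨(mul a (inv b.1), b.1), ⟨⟨?_, ?_⟩, ?_⟩, mul_inv_mul b.2⟩
  · exact subset_tsupport _ (left_ne_zero_of_mul hne)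
  · exact subset_tsupport _ (right_ne_zero_of_mul hne)
  · rw [composable_iff, dom_mul_inv b.2]

/-- The convolution of two continuous functions of compact support. -/
def convC [T2Space G] [IsEtale G] (f g : C_c(G, ℂ)) : C_c(G, ℂ) where
  toFun := conv f g
  continuous_toFun := continuous_conv f g
  hasCompactSupport' := hasCompactSupport_conv f g

end Convolution

/-! ### The left regular representations -/

/-- The complex Banach space `ℓ^p(S)`. -/
abbrev EllP (p : ℝ≥0∞) (S : Type*) : Type _ := lp (fun _ : S => ℂ) p

section Schur

variable {S : Type*} {A : S → S → ℂ} {N : ℕ} {C : ℝ}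

theorem schur_finite (hrow : ∀ s, {t | A s t ≠ 0}.encard ≤ N) (hC : ∀ s t, ‖A s t‖ ≤ C)
    (hcol : ∀ t, {s | A s t ≠ 0}.encard ≤ N) {q : ℝ} (hq : 1 ≤ q) (ξ : S → ℂ) (B : ℝ)
    (hB : ∀ T : Finset S, ∑ t ∈ T, ‖ξ t‖ ^ q ≤ B ^ q) (hB0 : 0 ≤ B) (hC0 : 0 ≤ C)
    (F : Finset S) :
    ∑ s ∈ F, ‖∑ᶠ t, A s t * ξ t‖ ^ q ≤ (N * C * B) ^ q := by
  classical
  have hfin : ∀ s, {t | A s t ≠ 0}.Finite := fun s => Set.finite_of_encard_le_coe (hrow s)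
  set R : S → Finset S := fun s => (hfin s).toFinset with hR
  have hRmem : ∀ s t, t ∈ R s ↔ A s t ≠ 0 := fun s t => by simp [hR]
  have hRcard : ∀ s, (R s).card ≤ N := fun s => by
    have := hrow s
    rw [← (hfin s).coe_toFinset, Set.encard_coe_eq_coe_finsetCard] at this
    exact_mod_cast this
  have hq0 : 0 ≤ q := zero_le_one.trans hq
  have step : ∀ s, ‖∑ᶠ t, A s t * ξ t‖ ^ q ≤
      C ^ q * ((N : ℝ) ^ (q - 1) * ∑ t ∈ R s, ‖ξ t‖ ^ q) := fun s => by
    rw [finsum_eq_sum_of_support_subset (s := R s) _ fun t ht =>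
      (hRmem s t).2 (left_ne_zero_of_mul ht)]
    have h1 : ‖∑ t ∈ R s, A s t * ξ t‖ ≤ C * ∑ t ∈ R s, ‖ξ t‖ := by
      rw [Finset.mul_sum]
      refine (norm_sum_le _ _).trans (Finset.sum_le_sum fun t _ => ?_)
      rw [norm_mul]
      exact mul_le_mul_of_nonneg_right (hC s t) (norm_nonneg _)
    refine (Real.rpow_le_rpow (norm_nonneg _) h1 hq0).trans ?_
    rw [Real.mul_rpow hC0 (Finset.sum_nonneg fun _ _ => norm_nonneg _)]
    refine mul_le_mul_of_nonneg_left ?_ (Real.rpow_nonneg hC0 _)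
    refine (Real.rpow_sum_le_const_mul_sum_rpow_of_nonneg (R s) hq
      fun _ _ => norm_nonneg _).trans ?_
    refine mul_le_mul_of_nonneg_right ?_
      (Finset.sum_nonneg fun _ _ => Real.rpow_nonneg (norm_nonneg _) _)
    exact Real.rpow_le_rpow (Nat.cast_nonneg _) (by exact_mod_cast hRcard s) (by linarith)
  have count : ∑ s ∈ F, ∑ t ∈ R s, ‖ξ t‖ ^ q ≤ N * B ^ q := by
    set T := F.biUnion R
    have h1 : ∀ s ∈ F, ∑ t ∈ R s, ‖ξ t‖ ^ q =
        ∑ t ∈ T, if A s t ≠ 0 then ‖ξ t‖ ^ q else 0 := fun s hs => by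
      rw [← Finset.sum_filter]
      refine Finset.sum_congr ?_ fun _ _ => rfl
      ext t
      rw [Finset.mem_filter, ← hRmem]
      exact ⟨fun h => ⟨Finset.mem_biUnion.2 ⟨s, hs, h⟩, h⟩, fun h => h.2⟩
    rw [Finset.sum_congr rfl h1, Finset.sum_comm]
    refine le_trans (Finset.sum_le_sum (g := fun t => (N : ℝ) * ‖ξ t‖ ^ q) fun t _ => ?_) ?_
    · rw [← Finset.sum_filter, Finset.sum_const, nsmul_eq_mul]
      refine mul_le_mul_of_nonneg_right ?_ (Real.rpow_nonneg (norm_nonneg _) _)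
      have h2 : ((F.filter fun s => A s t ≠ 0 : Finset S) : Set S).encard ≤ N := by
        refine (Set.encard_le_encard ?_).trans (hcol t)
        intro s hs
        exact (Finset.mem_filter.1 hs).2
      rw [Set.encard_coe_eq_coe_finsetCard] at h2
      exact_mod_cast h2
    · rw [← Finset.mul_sum]
      exact mul_le_mul_of_nonneg_left (hB T) (Nat.cast_nonneg _)
  calc ∑ s ∈ F, ‖∑ᶠ t, A s t * ξ t‖ ^ q
      ≤ ∑ s ∈ F, C ^ q * ((N : ℝ) ^ (q - 1) * ∑ t ∈ R s, ‖ξ t‖ ^ q) :=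
        Finset.sum_le_sum fun s _ => step s
    _ = C ^ q * ((N : ℝ) ^ (q - 1) * ∑ s ∈ F, ∑ t ∈ R s, ‖ξ t‖ ^ q) := by
        rw [← Finset.mul_sum, ← Finset.mul_sum]
    _ ≤ C ^ q * ((N : ℝ) ^ (q - 1) * (N * B ^ q)) := by
        refine mul_le_mul_of_nonneg_left (mul_le_mul_of_nonneg_left count ?_)
          (Real.rpow_nonneg hC0 _)
        exact Real.rpow_nonneg (Nat.cast_nonneg _) _
    _ = (N * C * B) ^ q := by
        rw [Real.mul_rpow (mul_nonneg (Nat.cast_nonneg _) hC0) hB0,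
          Real.mul_rpow (Nat.cast_nonneg _) hC0]
        have : (N : ℝ) ^ (q - 1) * N = (N : ℝ) ^ q := by
          rcases Nat.eq_zero_or_pos N with h | h
          · subst h
            rw [Nat.cast_zero, mul_zero, Real.zero_rpow (by linarith)]
          · rw [Real.rpow_sub_one (by positivity)]
            field_simp
        rw [← this]
        ring

theorem schur_sup (hrow : ∀ s, {t | A s t ≠ 0}.encard ≤ N) (hC : ∀ s t, ‖A s t‖ ≤ C)
    (ξ : S → ℂ) (B : ℝ) (hB : ∀ t, ‖ξ t‖ ≤ B) (hB0 : 0 ≤ B) (hC0 : 0 ≤ C) (s : S) :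
    ‖∑ᶠ t, A s t * ξ t‖ ≤ N * C * B := by
  have hfin : {t | A s t ≠ 0}.Finite := Set.finite_of_encard_le_coe (hrow s)
  have hcard : hfin.toFinset.card ≤ N := by
    have := hrow s
    rw [← hfin.coe_toFinset, Set.encard_coe_eq_coe_finsetCard] at this
    exact_mod_cast this
  rw [finsum_eq_sum_of_support_subset (s := hfin.toFinset) _ fun t ht => by
    simpa using left_ne_zero_of_mul ht]
  refine (norm_sum_le_of_le _ (f := fun t => A s t * ξ t) (n := fun _ => C * B)
    fun t _ => ?_).trans ?_
  · rw [norm_mul]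
    exact mul_le_mul (hC s t) (hB t) (norm_nonneg _) hC0
  · rw [Finset.sum_const, nsmul_eq_mul, ← _root_.mul_assoc]
    rw [_root_.mul_assoc, _root_.mul_assoc]
    exact mul_le_mul_of_nonneg_right (by exact_mod_cast hcard) (mul_nonneg hC0 hB0)

/-- A matrix with uniformly bounded entries and at most `N` nonzero entries in each row and each
column maps `ℓ^p` to `ℓ^p`. -/
theorem schur_memℓp (hrow : ∀ s, {t | A s t ≠ 0}.encard ≤ N) (hC : ∀ s t, ‖A s t‖ ≤ C)
    (hC0 : 0 ≤ C) (hcol : ∀ t, {s | A s t ≠ 0}.encard ≤ N) (p : ℝ≥0∞) [Fact (1 ≤ p)]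
    (ξ : EllP p S) : Memℓp (fun s => ∑ᶠ t, A s t * ξ t) p := by
  rcases eq_or_ne p ∞ with rfl | hp
  · refine memℓp_infty ⟨N * C * ‖ξ‖, ?_⟩
    rintro _ ⟨s, rfl⟩
    exact schur_sup hrow hC _ _ (lp.norm_apply_le_norm (by simp) ξ) (norm_nonneg _) hC0 s
  · have hq : 1 ≤ p.toReal := by
      simpa using ENNReal.toReal_mono hp (Fact.out : 1 ≤ p)
    exact memℓp_gen' (C := (N * C * ‖ξ‖) ^ p.toReal) fun F =>
      schur_finite hrow hC hcol hq _ _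
        (fun T => lp.sum_rpow_le_norm_rpow (zero_lt_one.trans_le hq) ξ T) (norm_nonneg _) hC0 F

theorem schur_norm_le (hrow : ∀ s, {t | A s t ≠ 0}.encard ≤ N) (hC : ∀ s t, ‖A s t‖ ≤ C)
    (hC0 : 0 ≤ C) (hcol : ∀ t, {s | A s t ≠ 0}.encard ≤ N) (p : ℝ≥0∞) [Fact (1 ≤ p)]
    (ξ η : EllP p S) (hη : ∀ s, η s = ∑ᶠ t, A s t * ξ t) : ‖η‖ ≤ N * C * ‖ξ‖ := by
  have h0 : 0 ≤ N * C * ‖ξ‖ := by positivity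
  rcases eq_or_ne p ∞ with rfl | hp
  · refine lp.norm_le_of_forall_le h0 fun s => ?_
    rw [hη]
    exact schur_sup hrow hC _ _ (lp.norm_apply_le_norm (by simp) ξ) (norm_nonneg _) hC0 s
  · have hq : 1 ≤ p.toReal := by
      simpa using ENNReal.toReal_mono hp (Fact.out : 1 ≤ p)
    refine lp.norm_le_of_forall_sum_le (zero_lt_one.trans_le hq) h0 fun F => ?_
    simp_rw [hη]
    exact schur_finite hrow hC hcol hq _ _
      (fun T => lp.sum_rpow_le_norm_rpow (zero_lt_one.trans_le hq) ξ T) (norm_nonneg _) hC0 F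

end Schur

section RegularRepresentation

theorem exists_norm_bound {G : Type*} [TopologicalSpace G] (f : C_c(G, ℂ)) : ∃ C : ℝ, 0 ≤ C ∧ ∀ a, ‖f a‖ ≤ C := by
  obtain ⟨C, hC⟩ := f.hasCompactSupport.exists_bound_of_continuous (map_continuous f)
  exact ⟨max C 0, le_max_right _ _, fun a => (hC a).trans (le_max_left _ _)⟩

open TopologicalGroupoid

variable {G : Type*} [TopologicalSpace G] [TopologicalGroupoid G]

theorem FiberBound.fiberConv_add {f : G → ℂ} {N : ℕ} (h : FiberBound f N) {x : G}
    (ξ η : Fiber x → ℂ) : fiberConv x f (ξ + η) = fiberConv x f ξ + fiberConv x f η := by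
  ext a
  have hR : ∀ b : Fiber x, f (mul a.1 (inv b.1)) ≠ 0 → b ∈ (h.finite_row a).toFinset :=
    fun b hb => by simpa using hb
  simp only [Pi.add_apply, fiberConv_eq_sum hR, mul_add, Finset.sum_add_distrib]

theorem FiberBound.fiberConv_smul {f : G → ℂ} {N : ℕ} (h : FiberBound f N) {x : G}
    (c : ℂ) (ξ : Fiber x → ℂ) : fiberConv x f (c • ξ) = c • fiberConv x f ξ := by
  ext a
  have hR : ∀ b : Fiber x, f (mul a.1 (inv b.1)) ≠ 0 → b ∈ (h.finite_row a).toFinset :=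
    fun b hb => by simpa using hb
  simp only [Pi.smul_apply, fiberConv_eq_sum hR, smul_eq_mul, Finset.mul_sum]
  exact Finset.sum_congr rfl fun b _ => by ring

theorem FiberBound.add_fiberConv {f g : G → ℂ} {N M : ℕ} (hf : FiberBound f N)
    (hg : FiberBound g M) {x : G} (ξ : Fiber x → ℂ) :
    fiberConv x (f + g) ξ = fiberConv x f ξ + fiberConv x g ξ := by
  classical
  ext a
  set R := (hf.finite_row a).toFinset ∪ (hg.finite_row a).toFinset with hRdef
  have hRf : ∀ b : Fiber x, f (mul a.1 (inv b.1)) ≠ 0 → b ∈ R := fun b hb => by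
    rw [hRdef, Finset.mem_union]; left; simpa using hb
  have hRg : ∀ b : Fiber x, g (mul a.1 (inv b.1)) ≠ 0 → b ∈ R := fun b hb => by
    rw [hRdef, Finset.mem_union]; right; simpa using hb
  have hR : ∀ b : Fiber x, (f + g) (mul a.1 (inv b.1)) ≠ 0 → b ∈ R := fun b hb => by
    by_contra hcon
    refine hb ?_
    rw [Pi.add_apply, not_not.1 (mt (hRf b) hcon), not_not.1 (mt (hRg b) hcon), add_zero]
  rw [Pi.add_apply, fiberConv_eq_sum hR, fiberConv_eq_sum hRf, fiberConv_eq_sum hRg,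
    ← Finset.sum_add_distrib]
  exact Finset.sum_congr rfl fun b _ => by rw [Pi.add_apply, add_mul]

theorem smul_fiberConv (c : ℂ) (f : G → ℂ) {x : G} (ξ : Fiber x → ℂ) :
    fiberConv x (c • f) ξ = c • fiberConv x f ξ := by
  ext a
  simp only [fiberConv, Pi.smul_apply, smul_finsum]
  exact finsum_congr fun b => by rw [smul_mul_assoc]

variable [IsEtale G]

theorem memℓp_fiberConv (p : ℝ≥0∞) [Fact (1 ≤ p)] (x : G) (f : C_c(G, ℂ)) (ξ : EllP p (Fiber x)) :
    Memℓp (fiberConv x f ξ) p := by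
  obtain ⟨N, hN⟩ := exists_fiberBound f
  obtain ⟨C, hC0, hC⟩ := exists_norm_bound f
  exact schur_memℓp (A := fun a b : Fiber x => f (mul a.1 (inv b.1))) hN.row
    (fun _ _ => hC _) hC0 hN.col p ξ

/-- The left regular representation `π_x` on `ℓ^p(Gx)`, where `Gx` is the set of arrows with
domain `x`: the operator `π_x(f)` is left convolution by `f`. -/
def regRep (p : ℝ≥0∞) [Fact (1 ≤ p)] (x : units G) (f : C_c(G, ℂ)) :
    EllP p (Fiber x.1) →L[ℂ] EllP p (Fiber x.1) :=
  LinearMap.mkContinuousOfExistsBound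
    { toFun := fun ξ => ⟨fiberConv x.1 f ξ, memℓp_fiberConv p x.1 f ξ⟩
      map_add' := fun ξ η => by
        obtain ⟨N, hN⟩ := exists_fiberBound f
        exact lp.ext (hN.fiberConv_add ξ η)
      map_smul' := fun c ξ => by
        obtain ⟨N, hN⟩ := exists_fiberBound f
        exact lp.ext (hN.fiberConv_smul c ξ) }
    (by
      obtain ⟨N, hN⟩ := exists_fiberBound f
      obtain ⟨C, hC0, hC⟩ := exists_norm_bound f
      exact ⟨N * C, fun ξ => schur_norm_le (A := fun a b : Fiber x.1 => f (mul a.1 (inv b.1)))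
        hN.row (fun _ _ => hC _) hC0 hN.col p ξ _ fun _ => rfl⟩)

theorem coe_regRep (p : ℝ≥0∞) [Fact (1 ≤ p)] (x : units G) (f : C_c(G, ℂ))
    (ξ : EllP p (Fiber x.1)) : ⇑(regRep p x f ξ) = fiberConv x.1 f ξ := rfl

theorem exists_norm_regRep_le (p : ℝ≥0∞) [Fact (1 ≤ p)] (f : C_c(G, ℂ)) :
    ∃ B : ℝ, 0 ≤ B ∧ ∀ x : units G, ‖regRep p x f‖ ≤ B := by
  obtain ⟨N, hN⟩ := exists_fiberBound f
  obtain ⟨C, hC0, hC⟩ := exists_norm_bound f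
  refine ⟨N * C, by positivity, fun x => ContinuousLinearMap.opNorm_le_bound _ (by positivity)
    fun ξ => ?_⟩
  exact schur_norm_le (A := fun a b : Fiber x.1 => f (mul a.1 (inv b.1)))
        hN.row (fun _ _ => hC _) hC0 hN.col p ξ _ fun _ => rfl

theorem regRep_add (p : ℝ≥0∞) [Fact (1 ≤ p)] (x : units G) (f g : C_c(G, ℂ)) :
    regRep p x (f + g) = regRep p x f + regRep p x g := by
  obtain ⟨N, hN⟩ := exists_fiberBound f
  obtain ⟨M, hM⟩ := exists_fiberBound g
  ext1 ξ
  exact lp.ext (hN.add_fiberConv hM ξ)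

theorem regRep_smul (p : ℝ≥0∞) [Fact (1 ≤ p)] (x : units G) (c : ℂ) (f : C_c(G, ℂ)) :
    regRep p x (c • f) = c • regRep p x f := by
  ext1 ξ
  exact lp.ext (smul_fiberConv c f ξ)

theorem regRep_convC [T2Space G] (p : ℝ≥0∞) [Fact (1 ≤ p)] (x : units G) (f g : C_c(G, ℂ)) :
    regRep p x (convC f g) = regRep p x f * regRep p x g := by
  obtain ⟨N, hN⟩ := exists_fiberBound f
  obtain ⟨M, hM⟩ := exists_fiberBound g
  ext1 ξ
  exact lp.ext (fiberConv_fiberConv hN hM ξ).symm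

theorem norm_apply_le_regRep (p : ℝ≥0∞) [Fact (1 ≤ p)] (f : C_c(G, ℂ)) (x : units G)
    (a : Fiber x.1) : ‖f a.1‖ ≤ ‖regRep p x f‖ := by
  classical
  have hp0 : 0 < p := zero_lt_one.trans_le Fact.out
  let u : Fiber x.1 := ⟨x.1, dom_of_mem_units x.2⟩
  have h1 : regRep p x f (lp.single p u (1 : ℂ)) a = f a.1 := by
    rw [coe_regRep, fiberConv, finsum_eq_single _ u]
    · rw [lp.single_apply_self, mul_one]
      congr 1
      have h0 : mul a.1 (inv x.1) = mul a.1 (dom a.1) := by rw [← x.2.1, a.2]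
      exact h0.trans (mul_dom_self a.1)
    · intro b hb
      rw [lp.single_apply_ne p u 1 hb, mul_zero]
  have h2 := (regRep p x f).le_opNorm (lp.single p u (1 : ℂ))
  rw [lp.norm_single (E := fun _ : Fiber x.1 => ℂ) hp0, norm_one, mul_one] at h2
  rw [← h1]
  exact (lp.norm_apply_le_norm hp0.ne' _ _).trans h2

end RegularRepresentation

/-! ### The reduced groupoid `L^p`-operator algebra -/

section ReducedAlgebra

open TopologicalGroupoid

variable (p : ℝ≥0∞) [Fact (1 ≤ p)] (G : Type*) [TopologicalSpace G] [TopologicalGroupoid G]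

/-- The convolution algebra `C_c(G)`; the index `p` selects the norm it is given below. -/
def ConvAlg (_p : ℝ≥0∞) (G : Type*) [TopologicalSpace G] : Type _ := C_c(G, ℂ)

instance (p : ℝ≥0∞) (G : Type*) [TopologicalSpace G] : AddCommGroup (ConvAlg p G) :=
  inferInstanceAs (AddCommGroup C_c(G, ℂ))

instance (p : ℝ≥0∞) (G : Type*) [TopologicalSpace G] : Module ℂ (ConvAlg p G) :=
  inferInstanceAs (Module ℂ C_c(G, ℂ))

instance (p : ℝ≥0∞) (G : Type*) [TopologicalSpace G] : FunLike (ConvAlg p G) G ℂ :=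
  inferInstanceAs (FunLike C_c(G, ℂ) G ℂ)

namespace ConvAlg

variable {p G}

@[ext]
theorem ext {f g : ConvAlg p G} (h : ∀ a, f a = g a) : f = g := DFunLike.ext _ _ h

/-- An element of the convolution algebra as a compactly supported continuous function. -/
def toC (f : ConvAlg p G) : C_c(G, ℂ) := f

/-- The norm `‖f‖_λ = sup_x ‖π_x(f)‖`. -/
instance [IsEtale G] : Norm (ConvAlg p G) := ⟨fun f => ⨆ x : units G, ‖regRep p x f.toC‖⟩

theorem norm_def [IsEtale G] (f : ConvAlg p G) : ‖f‖ = ⨆ x : units G, ‖regRep p x f.toC‖ := rfl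

theorem norm_regRep_le [IsEtale G] (f : ConvAlg p G) (x : units G) :
    ‖regRep p x f.toC‖ ≤ ‖f‖ := by
  obtain ⟨B, _, hB⟩ := exists_norm_regRep_le p f.toC
  exact le_ciSup (f := fun x : units G => ‖regRep p x f.toC‖)
    ⟨B, by rintro _ ⟨y, rfl⟩; exact hB y⟩ x

theorem norm_le_of_regRep [IsEtale G] (f : ConvAlg p G) {B : ℝ} (hB : 0 ≤ B)
    (h : ∀ x : units G, ‖regRep p x f.toC‖ ≤ B) : ‖f‖ ≤ B :=
  Real.iSup_le h hB

theorem norm_nonneg' [IsEtale G] (f : ConvAlg p G) : 0 ≤ ‖f‖ :=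
  Real.iSup_nonneg fun _ => norm_nonneg _

theorem norm_apply_le [IsEtale G] (f : ConvAlg p G) (a : G) : ‖f a‖ ≤ ‖f‖ :=
  (norm_apply_le_regRep p f.toC (domMap a) ⟨a, rfl⟩).trans (norm_regRep_le f _)

variable [T2Space G] [IsEtale G] [CompactSpace (units G)]

open scoped Classical in
/-- A continuous function on the compact (and open and closed) unit space, extended by zero to
all arrows. -/
def ofUnits (f : C(units G, ℂ)) : ConvAlg p G :=
  show C_c(G, ℂ) from
  { toFun := fun a => if h : a ∈ units G then f ⟨a, h⟩ else 0
    continuous_toFun := by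
      rw [continuous_iff_continuousAt]
      intro a
      by_cases ha : a ∈ units G
      · have := (isOpen_units (G := G)).isOpenEmbedding_subtypeVal.continuousAt_iff (x := ⟨a, ha⟩)
          (g := fun a => if h : a ∈ units G then f ⟨a, h⟩ else 0)
        refine this.1 ?_
        have h2 : ((fun a => if h : a ∈ units G then f ⟨a, h⟩ else 0) ∘ Subtype.val :
            units G → ℂ) = f := by
          ext b
          simp
        rw [h2]
        exact f.continuous.continuousAt
      · refine ContinuousAt.congr (f := fun _ => (0 : ℂ)) continuousAt_const ?_
        filter_upwards [isClosed_units.isOpen_compl.mem_nhds ha] with b hb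
        have hb' : b ∉ units G := hb
        rw [dif_neg hb']
    hasCompactSupport' := by
      refine HasCompactSupport.intro (isCompact_iff_compactSpace.2 ‹CompactSpace (units G)›)
        fun a ha => dif_neg ha }

theorem ofUnits_apply (f : C(units G, ℂ)) (u : units G) : (ofUnits f : ConvAlg p G) u.1 = f u :=
  dif_pos u.2

theorem ofUnits_apply_of_notMem (f : C(units G, ℂ)) {a : G} (h : a ∉ units G) :
    (ofUnits f : ConvAlg p G) a = 0 :=
  dif_neg h

instance : Mul (ConvAlg p G) := ⟨fun f g => convC f.toC g.toC⟩

/-- The unit of the convolution algebra is the characteristic function of the unit space. -/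
instance : One (ConvAlg p G) := ⟨ofUnits 1⟩

theorem mul_def (f g : ConvAlg p G) (a : G) : (f * g) a = conv f g a := rfl

theorem one_def : (1 : ConvAlg p G) = ofUnits 1 := rfl

theorem ofUnits_mul_apply (f : C(units G, ℂ)) (g : ConvAlg p G) (a : G) :
    ((ofUnits f : ConvAlg p G) * g) a = f (ranMap a) * g a := by
  rw [mul_def, conv, finsum_eq_single _ ⟨a, rfl⟩]
  · congr 1
    exact ofUnits_apply f (ranMap a)
  · rintro ⟨b, hb⟩ hne
    rw [ofUnits_apply_of_notMem, zero_mul]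
    intro hu
    refine hne (Subtype.ext ?_)
    have h1 := mul_inv_mul hb
    have h2 : mul a (inv b) = ran b := by
      rw [← dom_mul_inv hb, dom_of_mem_units hu]
    rwa [h2, ran_mul_self] at h1

theorem mul_ofUnits_apply (f : C(units G, ℂ)) (g : ConvAlg p G) (a : G) :
    (g * (ofUnits f : ConvAlg p G)) a = g a * f (domMap a) := by
  rw [mul_def, conv, finsum_eq_single _ ⟨dom a, dom_of_mem_units (dom_mem_units a)⟩]
  · congr 1
    · congr 1
      change mul a (inv (dom a)) = a
      rw [← (dom_mem_units a).1, mul_dom_self]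
    · exact ofUnits_apply f (domMap a)
  · rintro ⟨b, hb⟩ hne
    rw [ofUnits_apply_of_notMem f (a := b), mul_zero]
    intro hu
    exact hne (Subtype.ext ((dom_of_mem_units hu).symm.trans hb))

instance : Ring (ConvAlg p G) where
  __ := (inferInstance : AddCommGroup (ConvAlg p G))
  __ := (inferInstance : Mul (ConvAlg p G))
  __ := (inferInstance : One (ConvAlg p G))
  left_distrib f g h := by
    ext a
    obtain ⟨N, hN⟩ := exists_fiberBound f.toC
    exact congrFun (hN.fiberConv_add (x := dom a) (fun b => g b.1) (fun b => h b.1)) ⟨a, rfl⟩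
  right_distrib f g h := by
    ext a
    obtain ⟨N, hN⟩ := exists_fiberBound f.toC
    obtain ⟨M, hM⟩ := exists_fiberBound g.toC
    exact congrFun (hN.add_fiberConv hM (x := dom a) (fun b => h b.1)) ⟨a, rfl⟩
  zero_mul f := by
    ext a
    exact finsum_eq_zero_of_forall_eq_zero fun b => zero_mul _
  mul_zero f := by
    ext a
    exact finsum_eq_zero_of_forall_eq_zero fun b => mul_zero _
  mul_assoc f g h := by
    ext a
    obtain ⟨N, hN⟩ := exists_fiberBound f.toC
    obtain ⟨M, hM⟩ := exists_fiberBound g.toC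
    exact congrFun (conv_assoc hN hM h) a
  one_mul f := by
    ext a
    rw [one_def, ofUnits_mul_apply]
    exact one_mul _
  mul_one f := by
    ext a
    rw [one_def, mul_ofUnits_apply]
    exact mul_one _

instance : Algebra ℂ (ConvAlg p G) :=
  Algebra.ofModule
    (fun c f g => by
      ext a
      exact congrFun (smul_fiberConv c f (x := dom a) (fun b => g b.1)) ⟨a, rfl⟩)
    (fun c f g => by
      ext a
      obtain ⟨N, hN⟩ := exists_fiberBound f.toC
      exact congrFun (hN.fiberConv_smul (x := dom a) c (fun b => g b.1)) ⟨a, rfl⟩)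

variable (p G) in
/-- `‖·‖_λ` is a submultiplicative norm on the convolution algebra. -/
def ringNorm : RingNorm (ConvAlg p G) where
  toFun f := ‖f‖
  map_zero' := by
    refine le_antisymm (norm_le_of_regRep _ le_rfl fun x => ?_) (norm_nonneg' _)
    have : regRep p x (toC (0 : ConvAlg p G)) = 0 := by
      have := regRep_smul p x 0 (0 : C_c(G, ℂ))
      rw [zero_smul, zero_smul] at this
      exact this
    rw [this, norm_zero]
  add_le' f g := by
    refine norm_le_of_regRep _ (add_nonneg (norm_nonneg' _) (norm_nonneg' _)) fun x => ?_
    have := regRep_add p x f.toC g.toC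
    change ‖regRep p x (f.toC + g.toC)‖ ≤ _
    rw [this]
    exact (norm_add_le _ _).trans (add_le_add (norm_regRep_le f x) (norm_regRep_le g x))
  neg' f := by
    change (⨆ x : units G, ‖regRep p x (-f.toC)‖) = ⨆ x : units G, ‖regRep p x f.toC‖
    congr 1
    ext x
    have := regRep_smul p x (-1) f.toC
    rw [show (-1 : ℂ) • f.toC = -f.toC by ext; simp, neg_one_smul] at this
    rw [this, norm_neg]
  mul_le' f g := by
    refine norm_le_of_regRep _ (mul_nonneg (norm_nonneg' _) (norm_nonneg' _)) fun x => ?_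
    change ‖regRep p x (convC f.toC g.toC)‖ ≤ _
    rw [regRep_convC]
    exact (norm_mul_le _ _).trans (mul_le_mul (norm_regRep_le f x) (norm_regRep_le g x)
      (norm_nonneg _) (norm_nonneg' _))
  eq_zero_of_map_eq_zero' f hf := by
    ext a
    have := norm_apply_le f a
    rw [show ‖f‖ = 0 from hf] at this
    exact norm_le_zero_iff.1 this

instance : NormedRing (ConvAlg p G) where
  __ := (inferInstance : Ring (ConvAlg p G))
  __ := (inferInstance : Norm (ConvAlg p G))
  __ := (ringNorm p G).toNormedRing

instance : NormedAlgebra ℂ (ConvAlg p G) where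
  norm_smul_le c f := by
    refine norm_le_of_regRep _ (mul_nonneg (norm_nonneg _) (norm_nonneg' _)) fun x => ?_
    change ‖regRep p x (c • f.toC)‖ ≤ _
    rw [regRep_smul, norm_smul]
    exact mul_le_mul_of_nonneg_left (norm_regRep_le f x) (norm_nonneg _)

theorem ofUnits_mul (f g : C(units G, ℂ)) :
    (ofUnits (f * g) : ConvAlg p G) = ofUnits f * ofUnits g := by
  ext a
  rw [ofUnits_mul_apply]
  by_cases ha : a ∈ units G
  · rw [ofUnits_apply _ ⟨a, ha⟩, ofUnits_apply _ ⟨a, ha⟩,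
      show ranMap a = ⟨a, ha⟩ from Subtype.ext (ran_of_mem_units ha)]
    rfl
  · rw [ofUnits_apply_of_notMem _ ha, ofUnits_apply_of_notMem _ ha, mul_zero]

theorem ofUnits_add (f g : C(units G, ℂ)) :
    (ofUnits (f + g) : ConvAlg p G) = ofUnits f + ofUnits g := by
  ext a
  change _ = (ofUnits f : ConvAlg p G) a + (ofUnits g : ConvAlg p G) a
  by_cases ha : a ∈ units G
  · rw [ofUnits_apply _ ⟨a, ha⟩, ofUnits_apply _ ⟨a, ha⟩, ofUnits_apply _ ⟨a, ha⟩]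
    rfl
  · rw [ofUnits_apply_of_notMem _ ha, ofUnits_apply_of_notMem _ ha,
      ofUnits_apply_of_notMem _ ha, add_zero]

theorem ofUnits_smul (c : ℂ) (f : C(units G, ℂ)) :
    (ofUnits (c • f) : ConvAlg p G) = c • ofUnits f := by
  ext a
  change _ = c • (ofUnits f : ConvAlg p G) a
  by_cases ha : a ∈ units G
  · rw [ofUnits_apply _ ⟨a, ha⟩, ofUnits_apply _ ⟨a, ha⟩]
    rfl
  · rw [ofUnits_apply_of_notMem _ ha, ofUnits_apply_of_notMem _ ha, smul_zero]

/-- Extension by zero as a homomorphism of algebras. -/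
def ofUnitsHom : C(units G, ℂ) →ₐ[ℂ] ConvAlg p G :=
  AlgHom.ofLinearMap
    { toFun := ofUnits
      map_add' := ofUnits_add
      map_smul' := ofUnits_smul } rfl ofUnits_mul

end ConvAlg

variable [T2Space G] [IsEtale G] [CompactSpace (units G)]

/-- The reduced groupoid `L^p`-operator algebra `F^p_λ(G)`: the completion of the convolution
algebra `C_c(G)` in the norm `‖f‖_λ = sup_x ‖π_x(f)‖`. -/
def ReducedAlgebra : Type _ := UniformSpace.Completion (ConvAlg p G)

namespace ReducedAlgebra

instance : NormedRing (ReducedAlgebra p G) :=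
  inferInstanceAs (NormedRing (UniformSpace.Completion (ConvAlg p G)))

instance : CompleteSpace (ReducedAlgebra p G) :=
  inferInstanceAs (CompleteSpace (UniformSpace.Completion (ConvAlg p G)))

instance : Algebra ℂ (ReducedAlgebra p G) :=
  inferInstanceAs (Algebra ℂ (UniformSpace.Completion (ConvAlg p G)))

instance : NormedAlgebra ℂ (ReducedAlgebra p G) where
  norm_smul_le := _root_.norm_smul_le (α := ℂ) (β := UniformSpace.Completion (ConvAlg p G))

/-- The canonical homomorphism from `C_c(G)` to its completion `F^p_λ(G)`. -/
def ofConvAlg : ConvAlg p G →ₐ[ℂ] ReducedAlgebra p G where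
  __ := (UniformSpace.Completion.coeRingHom :
    ConvAlg p G →+* UniformSpace.Completion (ConvAlg p G))
  commutes' _ := rfl

/-- The canonical homomorphism `C(G⁽⁰⁾) → F^p_λ(G)`: extend a continuous function on the unit
space by zero to an element of `C_c(G)`, and regard it as an element of the completion. -/
def ofUnits : C(units G, ℂ) →ₐ[ℂ] ReducedAlgebra p G :=
  (ofConvAlg p G).comp ConvAlg.ofUnitsHom

end ReducedAlgebra

end ReducedAlgebra

/-! ### The `C^*`-core -/

section Core

variable {A : Type*} [NormedRing A] [NormedAlgebra ℂ A]

/-- An element `a` of a unital complex Banach algebra is hermitian if `‖exp(ita)‖ = 1` for all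
real `t`. -/
def IsHermitianElement (a : A) : Prop :=
  ∀ t : ℝ, ‖NormedSpace.exp ((Complex.I * t) • a)‖ = 1

variable (A) in
/-- The `C^*`-core `A_h + i A_h` of a unital `L^p`-operator algebra `A`, where `A_h` is the set of
hermitian elements of `A`. -/
def cstarCore : Set A :=
  {a | ∃ h k : A, IsHermitianElement h ∧ IsHermitianElement k ∧ a = h + Complex.I • k}

end Core

end LpGroupoid

namespace LpGroupoid

/-! ### Disjointly supported vectors and isometries of `ℓ^p` -/

section Disjointness

/-! For `p ≠ 2` the geometry of `ℓ^p` remembers its coordinates. By Lamperti's argument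
(`disjoint_support_of_isometry`), linear isometries carry disjointly supported vectors to disjointly
supported vectors: the defect in the `p`-parallelogram identity is a sum over coordinates of terms
of a single sign, each of which vanishes exactly when one of the two coordinates does. If `T` is
hermitian on `ℓ^p`, the operators `exp(itT)` are isometries and tend to the identity as `t → 0`. For
small `t` their diagonal entries are nonzero, which forces the off-diagonal entries to vanish;
differentiating at `0` shows that `T` is diagonal (`apply_single_eq_zero_of_norm_exp_le`).

Every element `a` of `F^p_λ(G)` has a bounded continuous coefficient function `coeff a` on `G`,
whose values are the matrix entries of the operators `π_x(a)`. For finite `p` it determines `a`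
(`coeff_injective`), because point masses span a dense subspace of `ℓ^p` and the `π_x` together
separate points. The representations are contractive, so they send hermitian elements to diagonal
operators. Hence the coefficients of a hermitian element vanish off the units, and the element is
the image of a continuous function on the unit space.

Conversely, `π_x` turns a function on the units into multiplication by its composite with the range
map. Extension by zero is therefore isometric (`isometry_ofUnits`) and takes real functions to
hermitian elements, since `exp(itf)` is unitary in `C(G⁽⁰⁾)`. -/

theorem rpow_add_rpow_lt {r x y : ℝ} (hr : 1 < r) (hx : 0 < x) (hy : 0 < y) :
    x ^ r + y ^ r < (x + y) ^ r := by
  have hr0 : 0 < r - 1 := by linarith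
  have h1 : x ^ (r - 1) < (x + y) ^ (r - 1) := Real.rpow_lt_rpow hx.le (by linarith) hr0
  have h2 : y ^ (r - 1) < (x + y) ^ (r - 1) := Real.rpow_lt_rpow hy.le (by linarith) hr0
  -- Splitting off one factor `z` leaves the power `r - 1`, whose strict monotonicity gives the
  -- inequality term by term.
  have key : ∀ z : ℝ, 0 < z → z ^ r = z * z ^ (r - 1) := fun z hz => by
    rw [Real.rpow_sub_one hz.ne']; field_simp
  rw [key x hx, key y hy, key (x + y) (by linarith), add_mul]
  exact add_lt_add (mul_lt_mul_of_pos_left h1 hx) (mul_lt_mul_of_pos_left h2 hy)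

theorem lt_rpow_add_rpow {r x y : ℝ} (hr : r < 1) (hx : 0 < x) (hy : 0 < y) :
    (x + y) ^ r < x ^ r + y ^ r := by
  have hr0 : r - 1 < 0 := by linarith
  have h1 : (x + y) ^ (r - 1) < x ^ (r - 1) := Real.rpow_lt_rpow_of_neg hx (by linarith) hr0
  have h2 : (x + y) ^ (r - 1) < y ^ (r - 1) := Real.rpow_lt_rpow_of_neg hy (by linarith) hr0
  have key : ∀ z : ℝ, 0 < z → z ^ r = z * z ^ (r - 1) := fun z hz => by
    rw [Real.rpow_sub_one hz.ne']; field_simp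
  rw [key x hx, key y hy, key (x + y) (by linarith), add_mul]
  exact add_lt_add (mul_lt_mul_of_pos_left h1 hx) (mul_lt_mul_of_pos_left h2 hy)

/-- The defect in the `q`-parallelogram identity for complex numbers. -/
def parallelogramDefect (q : ℝ) (z w : ℂ) : ℝ :=
  ‖z + w‖ ^ q + ‖z - w‖ ^ q - 2 * (‖z‖ ^ q + ‖w‖ ^ q)

theorem parallelogramDefect_eq_zero {q : ℝ} (hq : 0 < q) {z w : ℂ} (h : z = 0 ∨ w = 0) :
    parallelogramDefect q z w = 0 := by
  rcases h with rfl | rfl <;>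
    simp [parallelogramDefect, Real.zero_rpow hq.ne'] <;> ring

theorem norm_rpow_eq_sq_rpow (q : ℝ) (z : ℂ) : ‖z‖ ^ q = (‖z‖ ^ 2) ^ (q / 2) := by
  rw [← Real.rpow_natCast, ← Real.rpow_mul (norm_nonneg _)]
  congr 1
  push_cast
  ring

/-- Put `r = q / 2 > 1`. Convexity of `t ↦ t ^ r` and the parallelogram law for squares bound the
first two terms below by `2 (‖z‖² + ‖w‖²) ^ r`. Superadditivity of the power is strict because both
numbers are nonzero. -/
theorem parallelogramDefect_pos {q : ℝ} (hq : 2 < q) {z w : ℂ} (hz : z ≠ 0) (hw : w ≠ 0) :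
    0 < parallelogramDefect q z w := by
  have hr : 1 < q / 2 := by linarith
  have hpar : ‖z + w‖ ^ 2 + ‖z - w‖ ^ 2 = 2 * (‖z‖ ^ 2 + ‖w‖ ^ 2) := by
    have := parallelogram_law_with_norm ℝ z w
    simpa [pow_two] using this
  have h1 := (convexOn_rpow hr.le).2 (Set.mem_Ici.2 (sq_nonneg ‖z + w‖))
    (Set.mem_Ici.2 (sq_nonneg ‖z - w‖)) (by norm_num : (0 : ℝ) ≤ 1 / 2)
    (by norm_num : (0 : ℝ) ≤ 1 / 2) (by norm_num)
  have h2 := rpow_add_rpow_lt hr (x := ‖z‖ ^ 2) (y := ‖w‖ ^ 2) (by positivity) (by positivity)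
  simp only [smul_eq_mul] at h1
  rw [← mul_add, hpar, ← mul_assoc, show (1 / 2 : ℝ) * 2 = 1 by norm_num, one_mul] at h1
  rw [parallelogramDefect]
  simp only [norm_rpow_eq_sq_rpow q]
  linarith

/-- For `q / 2 < 1` the power is concave and strictly subadditive, so both estimates of the previous
case reverse. -/
theorem parallelogramDefect_neg {q : ℝ} (hq0 : 0 < q) (hq : q < 2) {z w : ℂ} (hz : z ≠ 0)
    (hw : w ≠ 0) : parallelogramDefect q z w < 0 := by
  have hr : q / 2 < 1 := by linarith
  have hpar : ‖z + w‖ ^ 2 + ‖z - w‖ ^ 2 = 2 * (‖z‖ ^ 2 + ‖w‖ ^ 2) := by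
    have := parallelogram_law_with_norm ℝ z w
    simpa [pow_two] using this
  have h1 := (Real.concaveOn_rpow (by linarith) hr.le).2 (Set.mem_Ici.2 (sq_nonneg ‖z + w‖))
    (Set.mem_Ici.2 (sq_nonneg ‖z - w‖)) (by norm_num : (0 : ℝ) ≤ 1 / 2)
    (by norm_num : (0 : ℝ) ≤ 1 / 2) (by norm_num)
  have h2 := lt_rpow_add_rpow hr (x := ‖z‖ ^ 2) (y := ‖w‖ ^ 2) (by positivity) (by positivity)
  simp only [smul_eq_mul] at h1
  rw [← mul_add, ← mul_add, hpar, ← mul_assoc, show (1 / 2 : ℝ) * 2 = 1 by norm_num, one_mul] at h1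
  rw [parallelogramDefect]
  simp only [norm_rpow_eq_sq_rpow q]
  linarith

/-! ### Isometries and hermitian operators on `ℓ^p` -/

variable {p : ℝ≥0∞} [Fact (1 ≤ p)] {S : Type*}

theorem toReal_pos_of_one_le (hp : p ≠ ∞) : 0 < p.toReal :=
  ENNReal.toReal_pos (zero_lt_one.trans_le (Fact.out : 1 ≤ p)).ne' hp

theorem hasSum_parallelogramDefect (hp : p ≠ ∞) (ξ η : EllP p S) :
    HasSum (fun s => parallelogramDefect p.toReal (ξ s) (η s))
      (‖ξ + η‖ ^ p.toReal + ‖ξ - η‖ ^ p.toReal - 2 * (‖ξ‖ ^ p.toReal + ‖η‖ ^ p.toReal)) := by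
  have h := fun ζ : EllP p S => lp.hasSum_norm (toReal_pos_of_one_le hp) ζ
  exact ((h (ξ + η)).add (h (ξ - η))).sub (((h ξ).add (h η)).mul_left 2)

/-- Lamperti: for `p ≠ 2`, isometries of `ℓ^p` preserve disjointness of supports. -/
theorem disjoint_support_of_isometry (hp : p ≠ ∞) (hp2 : p ≠ 2)
    (U : EllP p S →L[ℂ] EllP p S) (hU : ∀ ζ, ‖U ζ‖ = ‖ζ‖) {ξ η : EllP p S}
    (h : ∀ s, ξ s = 0 ∨ η s = 0) (s : S) : U ξ s = 0 ∨ U η s = 0 := by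
  have hq0 := toReal_pos_of_one_le hp
  have hq2 : p.toReal ≠ 2 := fun h2 => hp2 <| by
    rw [← ENNReal.ofReal_toReal hp, h2]; simp
  -- Disjoint supports make every coordinate defect zero, hence also the total defect. The total
  -- involves only norms, so `U` preserves it.
  have h0 : ‖ξ + η‖ ^ p.toReal + ‖ξ - η‖ ^ p.toReal
      - 2 * (‖ξ‖ ^ p.toReal + ‖η‖ ^ p.toReal) = 0 := by
    refine (hasSum_parallelogramDefect hp ξ η).unique ?_
    simp only [fun s => parallelogramDefect_eq_zero hq0 (h s)]
    exact hasSum_zero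
  have h1 := hasSum_parallelogramDefect hp (U ξ) (U η)
  rw [← map_add, ← map_sub, hU, hU, hU, hU, h0] at h1
  by_contra! hne
  -- All coordinate defects of `U ξ` and `U η` have the same sign and sum to zero, so each is zero.
  -- This contradicts strictness at `s`.
  rcases lt_or_gt_of_ne hq2 with hlt | hgt
  · have hle : ∀ t, 0 ≤ -parallelogramDefect p.toReal (U ξ t) (U η t) := fun t => by
      by_cases ht : U ξ t = 0 ∨ U η t = 0
      · rw [parallelogramDefect_eq_zero hq0 ht, neg_zero]
      · push Not at ht
        linarith [parallelogramDefect_neg hq0 hlt ht.1 ht.2]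
    have h2 := (hasSum_zero_iff_of_nonneg hle).1 (by simpa using h1.neg)
    have h3 := congrFun h2 s
    simp only [Pi.zero_apply] at h3
    linarith [parallelogramDefect_neg hq0 hlt hne.1 hne.2]
  · have hle : ∀ t, 0 ≤ parallelogramDefect p.toReal (U ξ t) (U η t) := fun t => by
      by_cases ht : U ξ t = 0 ∨ U η t = 0
      · rw [parallelogramDefect_eq_zero hq0 ht]
      · push Not at ht
        exact (parallelogramDefect_pos hgt ht.1 ht.2).le
    have h2 := (hasSum_zero_iff_of_nonneg hle).1 h1
    have h3 := congrFun h2 s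
    simp only [Pi.zero_apply] at h3
    linarith [parallelogramDefect_pos hgt hne.1 hne.2]

/-- The inverse `exp(-itT)` is a contraction too, and an invertible contraction with contractive
inverse is isometric. Assuming only `≤ 1` suits operators obtained through a contractive
representation. -/
theorem norm_exp_apply_of_norm_exp_le {E : Type*} [NormedAddCommGroup E] [NormedSpace ℂ E]
    [CompleteSpace E] {T : E →L[ℂ] E} (h : ∀ t : ℝ, ‖NormedSpace.exp ((Complex.I * t) • T)‖ ≤ 1)
    (t : ℝ) (ζ : E) : ‖NormedSpace.exp ((Complex.I * t) • T) ζ‖ = ‖ζ‖ := by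
  let +nondep : NormedAlgebra ℚ (E →L[ℂ] E) := .restrictScalars ℚ ℂ _
  have hle : ∀ (t : ℝ) (ζ : E), ‖NormedSpace.exp ((Complex.I * t) • T) ζ‖ ≤ ‖ζ‖ :=
    fun t ζ => (ContinuousLinearMap.le_opNorm _ ζ).trans
      (mul_le_of_le_one_left (norm_nonneg _) (h t))
  refine le_antisymm (hle t ζ) ?_
  have hmul : NormedSpace.exp ((Complex.I * (-t : ℝ)) • T) * NormedSpace.exp ((Complex.I * t) • T)
      = 1 := by
    rw [← NormedSpace.exp_add_of_commute
      (((Commute.refl T).smul_left _).smul_right _), ← add_smul]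
    simp [NormedSpace.exp_zero]
  have := hle (-t) (NormedSpace.exp ((Complex.I * t) • T) ζ)
  rwa [← mul_apply_eq_comp, hmul, one_apply_eq_self] at this

/-- For `p ≠ 2`, hermitian operators on `ℓ^p` are diagonal. -/
theorem apply_single_eq_zero_of_norm_exp_le [DecidableEq S] (hp : p ≠ ∞) (hp2 : p ≠ 2)
    {T : EllP p S →L[ℂ] EllP p S} (h : ∀ t : ℝ, ‖NormedSpace.exp ((Complex.I * t) • T)‖ ≤ 1)
    {b c : S} (hbc : c ≠ b) : T (lp.single p b (1 : ℂ)) c = 0 := by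
  -- Matrix entries as continuous functionals, so that they can be differentiated along `exp(itT)`.
  let ev : S → S → (EllP p S →L[ℂ] EllP p S) →L[ℂ] ℂ := fun i j =>
    (lp.evalCLM ℂ (fun _ : S => ℂ) p j).comp
      (ContinuousLinearMap.apply ℂ (EllP p S) (lp.single p i (1 : ℂ)))
  have hev : ∀ i j V, ev i j V = V (lp.single p i (1 : ℂ)) j := fun _ _ _ => rfl
  set U : ℝ → EllP p S →L[ℂ] EllP p S := fun t => NormedSpace.exp ((Complex.I * t) • T) with hUdef
  have hU0 : U 0 = 1 := by simp [hUdef, NormedSpace.exp_zero]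
  have hder : ∀ i j, HasDerivAt (fun t : ℝ => ev i j (U t)) (ev i j T * Complex.I) 0 := by
    intro i j
    -- The derivative is computed in a complex variable and restricted to real `t` at the end.
    have h1 := hasDerivAt_exp_smul_const T (Complex.I * ((0 : ℝ) : ℂ))
    simp only [Complex.ofReal_zero, mul_zero, zero_smul, NormedSpace.exp_zero, one_mul] at h1
    have h2 := (ev i j).hasFDerivAt.comp_hasDerivAt _ h1
    have h3 : HasDerivAt (fun u : ℂ => Complex.I * u) Complex.I ((0 : ℝ) : ℂ) := by
      simpa using (hasDerivAt_id ((0 : ℝ) : ℂ)).const_mul Complex.I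
    exact (HasDerivAt.comp ((0 : ℝ) : ℂ) (by simpa using h2) h3).comp_ofReal
  have hne : ∀ᶠ t in 𝓝 (0 : ℝ), ev c c (U t) ≠ 0 := (hder c c).continuousAt.eventually_ne <| by
    rw [hU0, hev, one_apply_eq_self, lp.single_apply_self]
    exact one_ne_zero
  -- The images of the point masses at `b` and `c` cannot both be nonzero at `c`, and for small `t`
  -- the image of the second is.
  have hzero : (fun t => ev b c (U t)) =ᶠ[𝓝 0] fun _ => 0 := by
    filter_upwards [hne] with t ht
    refine (disjoint_support_of_isometry hp hp2 (U t) (norm_exp_apply_of_norm_exp_le h t)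
      (ξ := lp.single p b (1 : ℂ)) (η := lp.single p c (1 : ℂ)) (fun s => ?_) c).resolve_right ht
    by_cases hs : s = b
    · exact Or.inr (lp.single_apply_ne p c 1 (by rw [hs]; exact hbc.symm))
    · exact Or.inl (lp.single_apply_ne p b 1 hs)
  have h0 := ((hder b c).congr_of_eventuallyEq hzero.symm).unique (hasDerivAt_const 0 (0 : ℂ))
  exact (mul_eq_zero.1 h0).resolve_right Complex.I_ne_zero

end Disjointness

/-! ### Representations and coefficients of the reduced algebra -/

section Coefficients

open TopologicalGroupoid

variable {p : ℝ≥0∞} [Fact (1 ≤ p)] {G : Type*} [TopologicalSpace G] [TopologicalGroupoid G]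
  [T2Space G] [IsEtale G] [CompactSpace (units G)]

namespace ReducedAlgebra

theorem isometry_ofConvAlg : Isometry (ofConvAlg p G) :=
  UniformSpace.Completion.coe_isometry (α := ConvAlg p G)

theorem denseRange_ofConvAlg : DenseRange (ofConvAlg p G) :=
  UniformSpace.Completion.denseRange_coe (α := ConvAlg p G)

theorem norm_ofConvAlg (f : ConvAlg p G) : ‖ofConvAlg p G f‖ = ‖f‖ :=
  isometry_ofConvAlg.norm_map_of_map_zero (map_zero _) f

variable (p G) in
/-- The canonical homomorphism `C_c(G) → F^p_λ(G)` as a continuous linear map. -/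
def ofConvAlgL : ConvAlg p G →L[ℂ] ReducedAlgebra p G :=
  ⟨(ofConvAlg p G).toLinearMap, isometry_ofConvAlg.continuous⟩

variable {E : Type*} [NormedAddCommGroup E] [NormedSpace ℂ E] [CompleteSpace E]

/-- The extension of a continuous linear map from `C_c(G)` to `F^p_λ(G)`. -/
def lift (φ : ConvAlg p G →L[ℂ] E) : ReducedAlgebra p G →L[ℂ] E :=
  φ.extend (ofConvAlgL p G)

theorem lift_ofConvAlg (φ : ConvAlg p G →L[ℂ] E) (f : ConvAlg p G) :
    lift φ (ofConvAlg p G f) = φ f :=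
  ContinuousLinearMap.extend_eq φ (e := ofConvAlgL p G) denseRange_ofConvAlg
    isometry_ofConvAlg.isUniformInducing f

/-- The representation `π_x` of `F^p_λ(G)` on `ℓ^p(Gx)` as a continuous linear map. -/
def repL (x : units G) :
    ReducedAlgebra p G →L[ℂ] (EllP p (Fiber x.1) →L[ℂ] EllP p (Fiber x.1)) :=
  lift (LinearMap.mkContinuous
    { toFun := fun f => regRep p x f.toC
      map_add' := fun f g => regRep_add p x f.toC g.toC
      map_smul' := fun c f => regRep_smul p x c f.toC } 1
    fun f => by rw [one_mul]; exact f.norm_regRep_le x)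

theorem repL_ofConvAlg (x : units G) (f : ConvAlg p G) :
    repL x (ofConvAlg p G f) = regRep p x f.toC :=
  lift_ofConvAlg _ f

theorem repL_mul (x : units G) (a b : ReducedAlgebra p G) :
    repL x (a * b) = repL x a * repL x b := by
  refine denseRange_ofConvAlg.induction_on₂
    (p := fun a b : ReducedAlgebra p G => repL x (a * b) = repL x a * repL x b) ?_ ?_ a b
  · exact isClosed_eq (by fun_prop) (by fun_prop)
  · intro f g
    rw [← map_mul]
    simp only [repL_ofConvAlg]
    exact regRep_convC p x f.toC g.toC

/-- If `a b⁻¹` is a unit, it equals its own domain `ran b`, so `a = (a b⁻¹) b = b`. Only the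
diagonal term of the convolution survives. -/
theorem regRep_ofUnits_apply (x : units G) (f : C(units G, ℂ)) (ξ : EllP p (Fiber x.1))
    (a : Fiber x.1) :
    regRep p x (ConvAlg.ofUnits f : ConvAlg p G).toC ξ a = f (ranMap a.1) * ξ a := by
  classical
  rw [coe_regRep, fiberConv, finsum_eq_single _ a]
  · congr 1
    exact ConvAlg.ofUnits_apply f (ranMap a.1)
  · intro b hne
    have h := b.2.trans a.2.symm
    have h0 : (ConvAlg.ofUnits f : ConvAlg p G).toC (mul a.1 (inv b.1)) = 0 := by
      refine ConvAlg.ofUnits_apply_of_notMem f fun hu => hne (Subtype.ext ?_)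
      have h1 := mul_inv_mul h
      rwa [← dom_of_mem_units hu, dom_mul_inv h, ran_mul_self] at h1
    rw [h0, zero_mul]

theorem repL_one (x : units G) : repL x (1 : ReducedAlgebra p G) = 1 := by
  rw [← map_one (ofConvAlg p G), repL_ofConvAlg, ConvAlg.one_def]
  ext1 ξ
  refine lp.ext (funext fun a => ?_)
  rw [regRep_ofUnits_apply]
  exact one_mul _

/-- The representation `π_x` of `F^p_λ(G)` on `ℓ^p(Gx)`. -/
def rep (x : units G) : ReducedAlgebra p G →ₐ[ℂ] (EllP p (Fiber x.1) →L[ℂ] EllP p (Fiber x.1)) :=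
  AlgHom.ofLinearMap (repL x).toLinearMap (repL_one x) (repL_mul x)

theorem continuous_rep (x : units G) :
    Continuous (rep x : ReducedAlgebra p G → EllP p (Fiber x.1) →L[ℂ] EllP p (Fiber x.1)) :=
  (repL x).continuous

theorem rep_ofConvAlg (x : units G) (f : ConvAlg p G) :
    rep x (ofConvAlg p G f) = regRep p x f.toC :=
  repL_ofConvAlg x f

theorem norm_rep_le (x : units G) (a : ReducedAlgebra p G) : ‖rep x a‖ ≤ ‖a‖ := by
  refine denseRange_ofConvAlg.induction_on (p := fun a : ReducedAlgebra p G => ‖rep x a‖ ≤ ‖a‖)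
    a (isClosed_le (continuous_rep x).norm continuous_norm) fun f => ?_
  rw [rep_ofConvAlg, norm_ofConvAlg]
  exact f.norm_regRep_le x

/-- The norm of `C_c(G)` is a supremum over the `π_x`. If `f` is within `ε / 2` of `a`, then `π_x(f)
= -π_x(a - f)` has norm at most `ε / 2` for every `x`, whence `‖f‖ ≤ ε / 2` and `‖a‖ ≤ ε`. -/
theorem eq_zero_of_rep_eq_zero {a : ReducedAlgebra p G} (h : ∀ x : units G, rep x a = 0) :
    a = 0 := by
  rw [← norm_le_zero_iff]
  refine le_of_forall_pos_le_add fun ε hε => ?_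
  obtain ⟨f, hf⟩ := denseRange_ofConvAlg.exists_dist_lt a (half_pos hε)
  rw [dist_eq_norm] at hf
  have h1 : ‖f‖ ≤ ε / 2 := ConvAlg.norm_le_of_regRep f (half_pos hε).le fun x => by
    have h2 := (norm_rep_le x (a - ofConvAlg p G f)).trans hf.le
    rwa [map_sub, h x, zero_sub, norm_neg, rep_ofConvAlg] at h2
  have h3 := norm_add_le (a - ofConvAlg p G f) (ofConvAlg p G f)
  rw [sub_add_cancel, norm_ofConvAlg] at h3
  linarith

/-- An element of `F^p_λ(G)` as a bounded continuous function on `G`: the continuous extension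
of the identity of `C_c(G)`. -/
def coeff : ReducedAlgebra p G →L[ℂ] BoundedContinuousFunction G ℂ :=
  lift (LinearMap.mkContinuous
    { toFun := fun f => BoundedContinuousFunction.ofNormedAddCommGroup f.toC
        (map_continuous f.toC) ‖f‖ f.norm_apply_le
      map_add' := fun _ _ => rfl
      map_smul' := fun _ _ => rfl } 1
    fun f => by
      rw [one_mul]
      exact BoundedContinuousFunction.norm_ofNormedAddCommGroup_le _ (norm_nonneg f)
        f.norm_apply_le)

theorem coeff_ofConvAlg (f : ConvAlg p G) (a : G) : coeff (ofConvAlg p G f) a = f a := by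
  rw [coeff, lift_ofConvAlg]
  rfl

/-- This ties abstract coefficients to operators. Both sides are continuous in `a`, and on `C_c(G)`
convolution with a point mass has a single term. -/
theorem rep_single_apply (x : units G) [DecidableEq (Fiber x.1)] (a : ReducedAlgebra p G) (b c : Fiber x.1) :
    rep x a (lp.single p b (1 : ℂ)) c = coeff a (mul c.1 (inv b.1)) := by
  refine denseRange_ofConvAlg.induction_on
    (p := fun a : ReducedAlgebra p G =>
      rep x a (lp.single p b (1 : ℂ)) c = coeff a (mul c.1 (inv b.1))) a ?_ fun f => ?_
  · refine isClosed_eq ?_ ?_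
    · exact (lp.evalCLM ℂ (fun _ : Fiber x.1 => ℂ) p c).continuous.comp
        ((ContinuousLinearMap.apply ℂ (EllP p (Fiber x.1))
          (lp.single (E := fun _ : Fiber x.1 => ℂ) p b 1)).continuous.comp
          (continuous_rep x))
    · exact (BoundedContinuousFunction.evalCLM ℂ _).continuous.comp coeff.continuous
  · rw [rep_ofConvAlg, coeff_ofConvAlg, coe_regRep, fiberConv, finsum_eq_single _ b]
    · rw [lp.single_apply_self, mul_one]
      rfl
    · intro d hd
      rw [lp.single_apply_ne p b 1 hd, mul_zero]

theorem coeff_injective (hp : p ≠ ∞) :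
    Function.Injective (coeff : ReducedAlgebra p G → BoundedContinuousFunction G ℂ) := by
  classical
  refine (injective_iff_map_eq_zero coeff).2 fun a ha => eq_zero_of_rep_eq_zero fun x => ?_
  have h1 : ∀ b : Fiber x.1, rep x a (lp.single p b (1 : ℂ)) = 0 := fun b => by
    refine lp.ext (funext fun c => ?_)
    rw [rep_single_apply, ha]
    rfl
  ext1 ξ
  -- Finiteness of `p` is needed for `ξ` to be the norm-convergent sum of its coordinates.
  have h2 := (lp.hasSum_single hp ξ).mapL (rep x a)
  refine h2.unique ?_
  have h3 : ∀ b : Fiber x.1, rep x a (lp.single p b (ξ b)) = 0 := fun b => by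
    rw [show lp.single p b (ξ b) = ξ b • lp.single (E := fun _ : Fiber x.1 => ℂ) p b (1 : ℂ) by
      rw [← lp.single_smul, smul_eq_mul, mul_one], map_smul, h1, smul_zero]
  simp only [h3]
  exact hasSum_zero

end ReducedAlgebra

/-! ### Functions on the unit space and the computation of the core -/

theorem ReducedAlgebra.isometry_ofUnits : Isometry (ReducedAlgebra.ofUnits p G) := by
  refine AddMonoidHomClass.isometry_of_norm _ fun f => ?_
  change ‖ReducedAlgebra.ofConvAlg p G (ConvAlg.ofUnits f)‖ = ‖f‖
  rw [ReducedAlgebra.norm_ofConvAlg]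
  refine le_antisymm (ConvAlg.norm_le_of_regRep _ (norm_nonneg _) fun x => ?_) ?_
  · refine ContinuousLinearMap.opNorm_le_bound _ (norm_nonneg _) fun ξ => ?_
    -- The bound is rewritten as the norm of the vector `‖f‖ • ξ`, which allows a coordinatewise
    -- comparison.
    rw [← norm_norm f, ← Complex.norm_real ‖f‖, ← norm_smul]
    refine lp.norm_mono (zero_lt_one.trans_le (Fact.out : 1 ≤ p)).ne' fun a => ?_
    rw [ReducedAlgebra.regRep_ofUnits_apply, lp.coeFn_smul, Pi.smul_apply, norm_smul, norm_mul,
      Complex.norm_real, norm_norm]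
    exact mul_le_mul_of_nonneg_right (f.norm_coe_le_norm _) (norm_nonneg _)
  -- Each value of `f` is a value of its extension, and these are bounded by `‖·‖_λ`.
  · refine (ContinuousMap.norm_le f (norm_nonneg _)).2 fun u => ?_
    rw [← ConvAlg.ofUnits_apply (p := p) f u]
    exact ConvAlg.norm_apply_le _ _

/-- An isometric homomorphism commutes with `exp` and preserves norms, which moves the question to
`C(G⁽⁰⁾)`. There `exp(itf)` is unitary. -/
theorem isHermitianElement_ofUnits [Nonempty G] {f : C(units G, ℂ)} (hf : IsSelfAdjoint f) :
    IsHermitianElement (ReducedAlgebra.ofUnits p G f) := by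
  let +nondep : NormedAlgebra ℚ C(units G, ℂ) := .restrictScalars ℚ ℂ _
  let +nondep : NormedAlgebra ℚ (ReducedAlgebra p G) := .restrictScalars ℚ ℂ _
  -- Unitaries have norm `1` only in a nontrivial algebra.
  have : Nonempty (units G) := (inferInstance : Nonempty G).map domMap
  intro t
  rw [← map_smul, ← NormedSpace.map_exp (ReducedAlgebra.ofUnits p G)
    ReducedAlgebra.isometry_ofUnits.continuous,
    ReducedAlgebra.isometry_ofUnits.norm_map_of_map_zero (map_zero _), mul_smul]
  have ht : IsSelfAdjoint ((t : ℂ) • f) :=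
    IsSelfAdjoint.smul (show star (t : ℂ) = t from Complex.conj_ofReal t) hf
  exact CStarRing.norm_coe_unitary (selfAdjoint.expUnitary ⟨(t : ℂ) • f, ht⟩)

/-- With `x = dom a`, the coefficient at `a` is the entry of `π_x(h)` in row `a` and column `x`. It
is off the diagonal because `a` is not a unit. -/
theorem coeff_eq_zero_of_isHermitianElement (hp : p ≠ ∞) (hp2 : p ≠ 2) {h : ReducedAlgebra p G}
    (hh : IsHermitianElement h) {a : G} (ha : a ∉ units G) : ReducedAlgebra.coeff h a = 0 := by
  classical
  let +nondep : NormedAlgebra ℚ (ReducedAlgebra p G) := .restrictScalars ℚ ℂ _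
  let x : units G := domMap a
  let +nondep : NormedAlgebra ℚ (EllP p (Fiber x.1) →L[ℂ] EllP p (Fiber x.1)) :=
    .restrictScalars ℚ ℂ _
  let u : Fiber x.1 := ⟨x.1, dom_of_mem_units x.2⟩
  let c : Fiber x.1 := ⟨a, rfl⟩
  have hcu : c ≠ u := fun hcu => ha <| by
    rw [show a = dom a from congrArg Subtype.val hcu]
    exact dom_mem_units a
  have h1 : ∀ t : ℝ, ‖NormedSpace.exp ((Complex.I * t) • ReducedAlgebra.rep x h)‖ ≤ 1 := fun t => by
    rw [← map_smul, ← NormedSpace.map_exp (ReducedAlgebra.rep x) (ReducedAlgebra.continuous_rep x),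
      ← hh t]
    exact ReducedAlgebra.norm_rep_le x _
  have h2 := apply_single_eq_zero_of_norm_exp_le hp hp2 h1 hcu
  rw [ReducedAlgebra.rep_single_apply] at h2
  have h3 : mul c.1 (inv u.1) = a := by
    change mul a (inv (dom a)) = a
    rw [← (dom_mem_units a).1, mul_dom_self]
  rwa [h3] at h2

/-- The preimage is the restriction of the coefficient function to the units. Its extension by zero
has the same coefficients as `h`, and coefficients determine the element. -/
theorem mem_range_ofUnits_of_coeff_eq_zero (hp : p ≠ ∞) {h : ReducedAlgebra p G}
    (hh : ∀ a ∉ units G, ReducedAlgebra.coeff h a = 0) :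
    h ∈ Set.range (ReducedAlgebra.ofUnits p G) := by
  refine ⟨(ReducedAlgebra.coeff h).toContinuousMap.restrict (units G),
    ReducedAlgebra.coeff_injective hp ?_⟩
  ext a
  change ReducedAlgebra.coeff (ReducedAlgebra.ofConvAlg p G (ConvAlg.ofUnits _)) a = _
  rw [ReducedAlgebra.coeff_ofConvAlg]
  by_cases ha : a ∈ units G
  · exact ConvAlg.ofUnits_apply _ ⟨a, ha⟩
  · rw [ConvAlg.ofUnits_apply_of_notMem _ ha, hh a ha]

theorem cstarCore_eq_range_ofUnits [Nonempty G] (hp : p ≠ ∞) (hp2 : p ≠ 2) :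
    cstarCore (ReducedAlgebra p G) = Set.range (ReducedAlgebra.ofUnits p G) := by
  ext a
  constructor
  · rintro ⟨h, k, hh, hk, rfl⟩
    obtain ⟨f, rfl⟩ := mem_range_ofUnits_of_coeff_eq_zero hp
      fun a ha => coeff_eq_zero_of_isHermitianElement hp hp2 hh ha
    obtain ⟨g, rfl⟩ := mem_range_ofUnits_of_coeff_eq_zero hp
      fun a ha => coeff_eq_zero_of_isHermitianElement hp hp2 hk ha
    -- The range is a complex subspace, so it suffices to have treated the two hermitian parts.
    exact ⟨f + Complex.I • g, by rw [map_add, map_smul]⟩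
  · rintro ⟨f, rfl⟩
    refine ⟨_, _, isHermitianElement_ofUnits (realPart f).2,
      isHermitianElement_ofUnits (imaginaryPart f).2, ?_⟩
    rw [← map_smul, ← map_add, realPart_add_I_smul_imaginaryPart]

end Coefficients

end LpGroupoid

theorem mainTheorem10 {G : Type*} [TopologicalSpace G] [T2Space G] [Nonempty G]
    [LpGroupoid.TopologicalGroupoid G] [LpGroupoid.IsEtale G]
    [CompactSpace (LpGroupoid.units G)]
    (p : ℝ≥0∞) [Fact (1 ≤ p)] (hp : p ≠ ∞) (hp2 : p ≠ 2) :
    Isometry (LpGroupoid.ReducedAlgebra.ofUnits p G) ∧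
      LpGroupoid.cstarCore (LpGroupoid.ReducedAlgebra p G) =
        Set.range (LpGroupoid.ReducedAlgebra.ofUnits p G) :=
  ⟨LpGroupoid.ReducedAlgebra.isometry_ofUnits, LpGroupoid.cstarCore_eq_range_ofUnits hp hp2⟩
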